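/- Let $n\ge 0$ and let $\nabla_n=\{\boldsymbol p=(p_1,\dots,p_n): 1\ge p_1\ge\dots\ge p_n\ge 0\}$. For $\boldsymbol p\in\nabla_n$ let $f(k)=f(k;\boldsymbol p)$, $k\in\mathbb Z$, be the probability function of the Poisson-binomial distribution, that is, of the number of successes in $n$ independent Bernoulli trials with success probabilities $p_1,\dots,p_n$ (so $f(k)=0$ unless $0\le k\le n$). Let $\mu(\boldsymbol p)=\sum_k k f(k)$ be its mean and let the mode $m(\boldsymbol p)$ be the set of all $k$ at which $f$ attains its maximum. Put $$\mathcal F_{k,n}=\{\boldsymbol p\in\nabla_n: f(k-1)=f(k)>0\},\qquad \mathcal M_{x,n}=\{\boldsymbol p\in\nabla_n:\mu(\boldsymbol p)=x\}.$$ 1. For $1\le k\le n$ the minimum and maximum of $\mu$ on $\mathcal F_{k,n}$ exist, and $$\min_{\mathcal F_{k,n}}\mu=k-1+\frac1{k+1},\qquad \max_{\mathcal F_{k,n}}\mu=k-\frac1{n-k+2}.$$ 2. For $0\le k\le n$ and $\boldsymbol p\in\nabla_n$, $$k-\frac1{n-k+2}<\mu(\boldsymbol p)<k+\frac1{k+2}\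 \Longrightarrow\ m(\boldsymbol p)=\{k\}.$$ 3. At each endpoint of this region the twin mode occurs for exactly one profile. For $1\le k\le n$ and $\mu(\boldsymbol p)=k-\frac1{n-k+2}$ one has $m(\boldsymbol p)=\{k-1,k\}$ if $\boldsymbol p=(\underbrace{1,\dots,1}_{k-1},\underbrace{\tfrac1{n-k+2},\dots,\tfrac1{n-k+2}}_{n-k+1})$ (a profile which has this mean), and $m(\boldsymbol p)=\{k\}$ otherwise. For $0\le k<n$ and $\mu(\boldsymbol p)=k+\frac1{k+2}$ one has $m(\boldsymbol p)=\{k,k+1\}$ if $\boldsymbol p=(\underbrace{\tfrac{k+1}{k+2},\dots,\tfrac{k+1}{k+2}}_{k+1},0,\dots,0)$ (a profile which has this mean), and $m(\boldsymbol p)=\{k\}$ otherwise. 4. For $1\le k\le n$ and every $x$ with $k-1+\frac1{k+1}<x<k-\frac1{n-k+2}$, each $\boldsymbol p\in\mathcal M_{x,n}$ has $m(\boldsymbol p)\in\{\{k-1\},\{k\},\{k-1,k\}\}$, and each of these three possibilities occurs for some $\boldsymbol p\in\mathcal M_{x,n}$. -/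

import Mathlib

/-- The simplex of success profiles of `n` Bernoulli trials,
`1 ≥ p₁ ≥ ⋯ ≥ pₙ ≥ 0` (0-indexed by `Fin n`). -/
def successSimplex (n : ℕ) : Set (Fin n → ℝ) :=
  {p | Antitone p ∧ ∀ i, 0 ≤ p i ∧ p i ≤ 1}

/-- The Poisson-binomial probability function: the probability that exactly `k` of `n`
independent Bernoulli trials with success probabilities `p i` succeed.  The sum runs over all
outcomes of the `n` trials, an outcome being coded by its set `A` of successful trials. -/
noncomputable def pbProb {n : ℕ} (p : Fin n → ℝ) (k : ℕ) : ℝ :=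
  ∑ A : Finset (Fin n), if A.card = k then (∏ i ∈ A, p i) * ∏ i ∈ Aᶜ, (1 - p i) else 0

/-- The mean of the Poisson-binomial distribution. -/
noncomputable def pbMean {n : ℕ} (p : Fin n → ℝ) : ℝ :=
  ∑ k ∈ Finset.range (n + 1), (k : ℝ) * pbProb p k

/-- The mode of the Poisson-binomial distribution, as the set of all points where the
probability function attains its maximum. -/
def pbMode {n : ℕ} (p : Fin n → ℝ) : Set ℕ :=
  {k | ∀ j, pbProb p j ≤ pbProb p k}

/-- The bifurcation set: profiles with `f(k-1) = f(k)`, the common value being a genuine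
(positive) probability.  It is empty for `k = 0`, in accordance with `f(-1) = 0`. -/
def bifurcationSet (k n : ℕ) : Set (Fin n → ℝ) :=
  {p | p ∈ successSimplex n ∧ 1 ≤ k ∧ pbProb p (k - 1) = pbProb p k ∧ 0 < pbProb p k}

/-- The section of the simplex by the hyperplane where the mean equals `x`. -/
def meanSection (x : ℝ) (n : ℕ) : Set (Fin n → ℝ) :=
  {p | p ∈ successSimplex n ∧ pbMean p = x}

/-- The profile `(k/(k+1), …, k/(k+1), 0, …, 0)` with `k` nonzero entries. -/
noncomputable def lowProfile (k n : ℕ) : Fin n → ℝ :=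
  fun i => if (i : ℕ) < k then (k : ℝ) / ((k : ℝ) + 1) else 0

/-- The profile `(1, …, 1, 1/(n-k+2), …, 1/(n-k+2))` with `k - 1` entries equal to one
(used for `1 ≤ k ≤ n`). -/
noncomputable def highProfile (k n : ℕ) : Fin n → ℝ :=
  fun i => if (i : ℕ) + 1 < k then 1 else 1 / ((n : ℝ) - (k : ℝ) + 2)

/-! The heart is one sign statement, `pbDiff_pos_or_isHighLike`: if `k - 1/(n-k+2) ≤ μ < k + 1`,
then `f(k) - f(k-1) > 0`, apart from rearrangements of the extremal profile, where the difference
vanishes. It rests on an exchange argument of Hoeffding type. With the sum of the entries fixed,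
changing two of them affects the difference only through their product, and affinely
(`pbDiff_sub_of_pair`). At a minimizer with two distinct interior entries the slope must vanish,
since the product can be both raised and lowered. One entry can then be pushed to 0 or 1 at no cost.
Iterating leaves a single interior value, that is, a shifted binomial law, whose difference is
explicit (`binomial_diff`). The extremal profile cannot arise from such a push, because there the
slope is positive (`IsHighLike.pairCoeff_pos`).

The reflection `p ↦ 1 - p` converts this into the sign of `f(k+1) - f(k)`
(`pbProb_succ_lt_or_eq_lowProfile`). Log-concavity makes the law unimodal, so these two signs
determine the mode. In the ambiguous band, explicit profiles give both signs of the difference, and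
convexity of the mean section supplies a zero in between. -/

section

open Polynomial Finset

/-! ### Generating polynomials, consecutive differences and the mean -/

/-- The probability generating polynomial of a Bernoulli variable with success probability `a`. -/
noncomputable def bernoulliGen (a : ℝ) : ℝ[X] := 1 + C a * (X - 1)

/-- The probability generating polynomial of the Poisson-binomial distribution. -/
noncomputable def pbGen {n : ℕ} (p : Fin n → ℝ) : ℝ[X] := ∏ i, bernoulliGen (p i)

/-- The difference `f(k) - f(k-1)` of the Poisson-binomial probability function, `f(-1) = 0`. -/
noncomputable def pbDiff {n : ℕ} (p : Fin n → ℝ) (k : ℕ) : ℝ := ((1 - X) * pbGen p).coeff k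

lemma bernoulliGen_one : bernoulliGen 1 = X := by simp [bernoulliGen]

lemma bernoulliGen_zero : bernoulliGen 0 = 1 := by simp [bernoulliGen]

lemma bernoulliGen_eq (a : ℝ) : bernoulliGen a = C a * X + C (1 - a) := by
  simp [bernoulliGen]; ring

lemma pbProb_eq_coeff {n : ℕ} (p : Fin n → ℝ) (k : ℕ) : pbProb p k = (pbGen p).coeff k := by
  unfold pbProb pbGen
  simp_rw [bernoulliGen_eq]
  rw [Finset.prod_add, Polynomial.finsetSum_coeff, Finset.powerset_univ]
  refine Finset.sum_congr rfl fun A _ => ?_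
  rw [Finset.prod_mul_distrib, Finset.prod_const, ← map_prod, ← map_prod,
    ← Finset.compl_eq_univ_sdiff, mul_right_comm, ← C_mul, coeff_C_mul, coeff_X_pow]
  by_cases h : A.card = k
  · simp [h]
  · simp [h, Ne.symm h]

lemma coeff_one_sub_X_mul_succ (P : ℝ[X]) (k : ℕ) :
    ((1 - X) * P).coeff (k + 1) = P.coeff (k + 1) - P.coeff k := by
  rw [sub_mul, one_mul, coeff_sub, coeff_X_mul]

lemma coeff_one_sub_X_mul_zero (P : ℝ[X]) : ((1 - X) * P).coeff 0 = P.coeff 0 := by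
  simp [sub_mul]

lemma pbDiff_zero {n : ℕ} (p : Fin n → ℝ) : pbDiff p 0 = pbProb p 0 := by
  rw [pbDiff, coeff_one_sub_X_mul_zero, pbProb_eq_coeff]

lemma pbDiff_succ {n : ℕ} (p : Fin n → ℝ) (k : ℕ) :
    pbDiff p (k + 1) = pbProb p (k + 1) - pbProb p k := by
  rw [pbDiff, coeff_one_sub_X_mul_succ, pbProb_eq_coeff, pbProb_eq_coeff]

lemma continuous_pbProb {n : ℕ} (k : ℕ) : Continuous fun p : Fin n → ℝ => pbProb p k := by
  unfold pbProb
  refine continuous_finsetSum _ fun A _ => ?_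
  split_ifs <;> fun_prop

lemma continuous_pbDiff {n : ℕ} (k : ℕ) : Continuous fun p : Fin n → ℝ => pbDiff p k := by
  cases k with
  | zero => simpa only [pbDiff_zero] using continuous_pbProb 0
  | succ k =>
    simp only [pbDiff_succ]
    exact (continuous_pbProb (k + 1)).sub (continuous_pbProb k)

lemma pbProb_nonneg {n : ℕ} {p : Fin n → ℝ} (hp : ∀ i, 0 ≤ p i ∧ p i ≤ 1) (k : ℕ) :
    0 ≤ pbProb p k := by
  refine Finset.sum_nonneg fun A _ => ?_
  split_ifs
  · exact mul_nonneg (Finset.prod_nonneg fun i _ => (hp i).1)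
      (Finset.prod_nonneg fun i _ => sub_nonneg.2 (hp i).2)
  · exact le_rfl

lemma pbProb_pos_of_pbDiff_pos {n : ℕ} {p : Fin n → ℝ} (hp : ∀ i, 0 ≤ p i ∧ p i ≤ 1) {k : ℕ}
    (h : 0 < pbDiff p k) : 0 < pbProb p k := by
  cases k with
  | zero => rwa [pbDiff_zero] at h
  | succ k => rw [pbDiff_succ] at h; linarith [pbProb_nonneg hp k]

/-- The mean is the derivative of the generating polynomial at 1, where every factor equals 1 and
has slope `p i`. -/
lemma pbMean_eq_sum {n : ℕ} (p : Fin n → ℝ) : pbMean p = ∑ i, p i := by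
  have hdeg : (pbGen p).natDegree ≤ n := by
    refine (natDegree_prod_le _ _).trans ?_
    refine (Finset.sum_le_card_nsmul univ _ 1 fun i _ => ?_).trans (by simp)
    rw [bernoulliGen_eq]
    exact natDegree_linear_le
  have h1 : (derivative (pbGen p)).eval 1 = pbMean p := by
    rw [derivative_eval, Polynomial.sum_over_range' _ (by simp) (n + 1) (by omega)]
    refine Finset.sum_congr rfl fun k _ => ?_
    rw [pbProb_eq_coeff]; simp [mul_comm]
  rw [← h1, pbGen, derivative_prod_finset, eval_finsetSum]
  refine Finset.sum_congr rfl fun i _ => ?_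
  simp [bernoulliGen, eval_prod]

/-! ### Permutation and reflection symmetry -/

lemma pbGen_comp_equiv {n : ℕ} (p : Fin n → ℝ) (e : Fin n ≃ Fin n) :
    pbGen (p ∘ e) = pbGen p := by
  unfold pbGen
  exact Equiv.prod_comp e fun i => bernoulliGen (p i)

lemma pbProb_one_sub {n : ℕ} (p : Fin n → ℝ) {k l : ℕ} (h : k + l = n) :
    pbProb (fun i => 1 - p i) k = pbProb p l := by
  unfold pbProb
  refine Fintype.sum_equiv (Equiv.ofBijective _ (compl_bijective (α := Finset (Fin n)))) _ _
    fun A => ?_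
  have hA : A.card + Aᶜ.card = n := by simp
  simp only [Equiv.ofBijective_apply, compl_compl, sub_sub_cancel]
  rw [mul_comm]
  exact if_congr (by omega) rfl rfl

lemma pbProb_eq_zero_of_lt {n : ℕ} (p : Fin n → ℝ) {k : ℕ} (h : n < k) : pbProb p k = 0 := by
  refine Finset.sum_eq_zero fun A _ => if_neg ?_
  have := A.card_le_univ
  simp at this; omega

/-- The reflected profile `(1 - pₙ, …, 1 - p₁)`. -/
def reflectProfile {n : ℕ} (p : Fin n → ℝ) : Fin n → ℝ := fun i => 1 - p i.rev

lemma pbProb_reflectProfile {n : ℕ} (p : Fin n → ℝ) {k l : ℕ} (h : k + l = n) :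
    pbProb (reflectProfile p) k = pbProb p l := by
  have : reflectProfile p = (fun i => 1 - p i) ∘ Fin.revPerm := rfl
  rw [pbProb_eq_coeff, this, pbGen_comp_equiv, ← pbProb_eq_coeff, pbProb_one_sub p h]

lemma pbMean_reflectProfile {n : ℕ} (p : Fin n → ℝ) :
    pbMean (reflectProfile p) = n - pbMean p := by
  simp only [pbMean_eq_sum, reflectProfile, Finset.sum_sub_distrib]
  simpa using Equiv.sum_comp Fin.revPerm p

lemma reflectProfile_mem {n : ℕ} {p : Fin n → ℝ} (hp : p ∈ successSimplex n) :
    reflectProfile p ∈ successSimplex n := by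
  refine ⟨fun i j hij => ?_, fun i => ?_⟩
  · have := hp.1 (Fin.rev_le_rev.2 hij)
    simp only [reflectProfile]; linarith
  · have := hp.2 i.rev
    simp only [reflectProfile]; constructor <;> linarith

/-! ### Log-concavity, unimodality and the mode -/

lemma coeff_bernoulliGen_mul_zero (a : ℝ) (P : ℝ[X]) :
    (bernoulliGen a * P).coeff 0 = (1 - a) * P.coeff 0 := by
  rw [bernoulliGen_eq]; simp [mul_coeff_zero]

lemma coeff_bernoulliGen_mul_succ (a : ℝ) (P : ℝ[X]) (k : ℕ) :
    (bernoulliGen a * P).coeff (k + 1) = (1 - a) * P.coeff (k + 1) + a * P.coeff k := by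
  rw [bernoulliGen_eq, add_mul, mul_assoc, coeff_add, coeff_C_mul, coeff_C_mul, coeff_X_mul,
    add_comm]

/-- A sequence that is log-concave without internal zeros stays so when a Bernoulli variable is
added. -/
lemma logConcave_bernoulliGen_mul {a : ℝ} (h0 : 0 ≤ a) (h1 : a ≤ 1) {P : ℝ[X]}
    (hP : ∀ k, 0 ≤ P.coeff k)
    (h : ∀ i j, i < j → P.coeff i * P.coeff (j + 1) ≤ P.coeff (i + 1) * P.coeff j) {i j : ℕ}
    (hij : i < j) :
    (bernoulliGen a * P).coeff i * (bernoulliGen a * P).coeff (j + 1) ≤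
      (bernoulliGen a * P).coeff (i + 1) * (bernoulliGen a * P).coeff j := by
  obtain ⟨j, rfl⟩ : ∃ l, j = l + 1 := ⟨j - 1, by omega⟩
  have hb : 0 ≤ 1 - a := by linarith
  have e1 := mul_nonneg (mul_nonneg hb hb) (sub_nonneg.2 (h i (j + 1) hij))
  cases i with
  | zero =>
    simp only [coeff_bernoulliGen_mul_zero, coeff_bernoulliGen_mul_succ] at *
    have e2 := mul_nonneg (mul_nonneg h0 h0) (mul_nonneg (hP 0) (hP j))
    have e3 := mul_nonneg (mul_nonneg h0 hb) (mul_nonneg (hP 1) (hP j))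
    simp only [zero_add] at *
    nlinarith
  | succ i =>
    simp only [coeff_bernoulliGen_mul_succ]
    have e2 := mul_nonneg (mul_nonneg h0 h0) (sub_nonneg.2 (h i j (by omega)))
    -- The mixed term in `a * (1 - a)` compares indices two apart: chain two instances of `h`, or
    -- use one when `j = i + 1`, where the two middle indices coincide.
    have h3 : P.coeff i * P.coeff (j + 1 + 1) ≤ P.coeff (i + 1 + 1) * P.coeff j := by
      rcases Nat.lt_or_ge (i + 1) j with hlt | hge
      · exact (h i (j + 1) (by omega)).trans (h (i + 1) j hlt)
      · obtain rfl : j = i + 1 := by omega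
        have := h i (i + 1 + 1) (by omega)
        linarith
    have e3 := mul_nonneg (mul_nonneg h0 hb) (sub_nonneg.2 h3)
    nlinarith

lemma coeff_prod_bernoulliGen {ι : Type*} (s : Finset ι) {p : ι → ℝ}
    (hp : ∀ i, 0 ≤ p i ∧ p i ≤ 1) :
    (∀ k, 0 ≤ (∏ i ∈ s, bernoulliGen (p i)).coeff k) ∧ ∀ i j, i < j →
      (∏ i ∈ s, bernoulliGen (p i)).coeff i * (∏ i ∈ s, bernoulliGen (p i)).coeff (j + 1) ≤
      (∏ i ∈ s, bernoulliGen (p i)).coeff (i + 1) * (∏ i ∈ s, bernoulliGen (p i)).coeff j := by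
  classical
  induction s using Finset.induction_on with
  | empty =>
    refine ⟨fun k => ?_, fun i j _ => ?_⟩
    · simp only [prod_empty, coeff_one]; split_ifs <;> norm_num
    · simp [coeff_one]
  | insert a s ha ih =>
    rw [Finset.prod_insert ha]
    refine ⟨fun k => ?_, fun i j hij =>
      logConcave_bernoulliGen_mul (hp a).1 (hp a).2 ih.1 ih.2 hij⟩
    have hb := sub_nonneg.2 (hp a).2
    cases k with
    | zero =>
      rw [coeff_bernoulliGen_mul_zero]
      exact mul_nonneg hb (ih.1 0)
    | succ k =>
      rw [coeff_bernoulliGen_mul_succ]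
      exact add_nonneg (mul_nonneg hb (ih.1 _)) (mul_nonneg (hp a).1 (ih.1 _))

lemma pbProb_mul_le {n : ℕ} {p : Fin n → ℝ} (hp : ∀ i, 0 ≤ p i ∧ p i ≤ 1) {i j : ℕ}
    (hij : i < j) : pbProb p i * pbProb p (j + 1) ≤ pbProb p (i + 1) * pbProb p j := by
  simp only [pbProb_eq_coeff]
  exact (coeff_prod_bernoulliGen univ hp).2 i j hij

/-- The ratios `f(j+1)/f(j)` decrease, so a weak ascent at `a` forces one at every earlier index.
Log-concavity across gaps lets the single positive value `f(a+1)` be cancelled, so no other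
positivity is needed. -/
lemma pbProb_le_of_le {n : ℕ} {p : Fin n → ℝ} (hp : ∀ i, 0 ≤ p i ∧ p i ≤ 1) {a : ℕ}
    (h : pbProb p a ≤ pbProb p (a + 1)) (ha : 0 < pbProb p (a + 1)) {j : ℕ} (hj : j ≤ a) :
    pbProb p j ≤ pbProb p a := by
  induction hj using Nat.decreasingInduction with
  | self => exact le_rfl
  | of_succ j hj ih =>
    refine le_trans ?_ ih
    have h1 := pbProb_mul_le hp hj
    have h2 := mul_le_mul_of_nonneg_left h (pbProb_nonneg hp (j + 1))
    exact le_of_mul_le_mul_right (h1.trans h2) ha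

lemma pbProb_le_of_ge {n : ℕ} {p : Fin n → ℝ} (hp : ∀ i, 0 ≤ p i ∧ p i ≤ 1) {a : ℕ}
    (h : pbProb p (a + 1) ≤ pbProb p a) (ha : 0 < pbProb p a) {j : ℕ} (hj : a + 1 ≤ j) :
    pbProb p (j + 1) ≤ pbProb p j := by
  have h1 := pbProb_mul_le hp (show a < j by omega)
  have h2 := mul_le_mul_of_nonneg_right h (pbProb_nonneg hp j)
  exact le_of_mul_le_mul_left (h1.trans h2) ha

lemma pbProb_le_succ_of_ge {n : ℕ} {p : Fin n → ℝ} (hp : ∀ i, 0 ≤ p i ∧ p i ≤ 1) {a : ℕ}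
    (h : pbProb p (a + 1) ≤ pbProb p a) (ha : 0 < pbProb p a) {j : ℕ} (hj : a + 1 ≤ j) :
    pbProb p j ≤ pbProb p (a + 1) := by
  induction j, hj using Nat.le_induction with
  | base => exact le_rfl
  | succ j hj ih => exact (pbProb_le_of_ge hp h ha hj).trans ih

lemma pbProb_lt_of_pbDiff_pos {n : ℕ} {p : Fin n → ℝ} (hp : ∀ i, 0 ≤ p i ∧ p i ≤ 1) {k j : ℕ}
    (h : 0 < pbDiff p k) (hj : j < k) : pbProb p j < pbProb p k := by
  obtain ⟨k, rfl⟩ : ∃ l, k = l + 1 := ⟨k - 1, by omega⟩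
  have hk := pbProb_pos_of_pbDiff_pos hp h
  rw [pbDiff_succ] at h
  linarith [pbProb_le_of_le hp (by linarith) hk (show j ≤ k by omega)]

lemma pbProb_lt_of_succ_lt {n : ℕ} {p : Fin n → ℝ} (hp : ∀ i, 0 ≤ p i ∧ p i ≤ 1) {k j : ℕ}
    (h : pbProb p (k + 1) < pbProb p k) (hj : k < j) : pbProb p j < pbProb p k :=
  (pbProb_le_succ_of_ge hp h.le ((pbProb_nonneg hp _).trans_lt h) hj).trans_lt h

lemma pbMode_eq_singleton {n : ℕ} {p : Fin n → ℝ} (hp : ∀ i, 0 ≤ p i ∧ p i ≤ 1) {k : ℕ}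
    (h : 0 < pbDiff p k) (h' : pbProb p (k + 1) < pbProb p k) : pbMode p = {k} := by
  have key : ∀ j, j ≠ k → pbProb p j < pbProb p k := fun j hj =>
    (lt_or_gt_of_ne hj).elim (pbProb_lt_of_pbDiff_pos hp h) (pbProb_lt_of_succ_lt hp h')
  ext j
  simp only [pbMode, Set.mem_ofPred_eq, Set.mem_singleton_iff]
  refine ⟨fun hj => by_contra fun hne => (key j hne).not_ge (hj k), ?_⟩
  rintro rfl i
  by_cases hi : i = j
  · rw [hi]
  · exact (key i hi).le

lemma pbMode_eq_pair {n : ℕ} {p : Fin n → ℝ} (hp : ∀ i, 0 ≤ p i ∧ p i ≤ 1) {k : ℕ}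
    (h : 0 < pbDiff p k) (he : pbProb p k = pbProb p (k + 1))
    (h' : pbProb p (k + 1 + 1) < pbProb p (k + 1)) : pbMode p = {k, k + 1} := by
  have key : ∀ j, j ≠ k → j ≠ k + 1 → pbProb p j < pbProb p k := fun j hj hj' => by
    rcases lt_or_gt_of_ne hj with hlt | hgt
    · exact pbProb_lt_of_pbDiff_pos hp h hlt
    · exact he ▸ pbProb_lt_of_succ_lt hp h' (by omega)
  have hmax : ∀ j, pbProb p j ≤ pbProb p k := fun j => by
    by_cases h1 : j = k
    · rw [h1]
    by_cases h2 : j = k + 1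
    · rw [h2, he]
    exact (key j h1 h2).le
  ext j
  simp only [pbMode, Set.mem_ofPred_eq, Set.mem_insert_iff, Set.mem_singleton_iff]
  refine ⟨fun hj => by_contra fun hne => ?_, ?_⟩
  · rw [not_or] at hne
    exact (key j hne.1 hne.2).not_ge (hj k)
  · rintro (rfl | rfl) i
    · exact hmax i
    · exact he ▸ hmax i

/-! ### Exchanging mass between two entries -/

/-- The profiles, in any order, with prescribed sum. -/
def boxSection (x : ℝ) (n : ℕ) : Set (Fin n → ℝ) :=
  {p | (∀ i, 0 ≤ p i ∧ p i ≤ 1) ∧ ∑ i, p i = x}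

/-- The profile is a rearrangement of `highProfile k n`. -/
def IsHighLike {n : ℕ} (k : ℕ) (p : Fin n → ℝ) : Prop :=
  (∀ i, p i = 1 ∨ p i = 1 / ((n : ℝ) - k + 2)) ∧ #{i | p i = 1} + 1 = k

/-- The indices of the success probabilities different from `0` and `1`. -/
noncomputable def interiorIndices {n : ℕ} (p : Fin n → ℝ) : Finset (Fin n) := {i | p i ≠ 0 ∧ p i ≠ 1}

/-- Half the second-order coefficient of `pbDiff p k` with respect to the pair `p i`, `p j`. -/
noncomputable def pairCoeff {n : ℕ} (p : Fin n → ℝ) (k : ℕ) (i j : Fin n) : ℝ :=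
  ((1 - X) * ((X - 1) ^ 2 * ∏ l ∈ (univ.erase i).erase j, bernoulliGen (p l))).coeff k

lemma isCompact_boxSection (x : ℝ) (n : ℕ) : IsCompact (boxSection x n) := by
  have h : boxSection x n = Set.Icc 0 1 ∩ {p | ∑ i, p i = x} := by
    ext p
    simp only [boxSection, Set.mem_ofPred_eq, Set.mem_inter_iff, Set.mem_Icc, Pi.le_def,
      Pi.zero_apply, Pi.one_apply, forall_and]
  rw [h]
  exact isCompact_Icc.inter_right (isClosed_eq (by fun_prop) continuous_const)

lemma pbGen_eq_pair {n : ℕ} (p : Fin n → ℝ) {i j : Fin n} (hij : i ≠ j) :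
    pbGen p = bernoulliGen (p i) * (bernoulliGen (p j) *
      ∏ l ∈ (univ.erase i).erase j, bernoulliGen (p l)) := by
  rw [Finset.mul_prod_erase _ (fun l => bernoulliGen (p l))
    (Finset.mem_erase.2 ⟨hij.symm, mem_univ _⟩),
    Finset.mul_prod_erase _ (fun l => bernoulliGen (p l)) (mem_univ _), pbGen]

/-- With `Y = X - 1`, the two factors multiply to `1 + (a + b) Y + a b Y ^ 2`, so at fixed `a + b`
only the product `a b` matters. -/
lemma pbDiff_sub_of_pair {n : ℕ} (p q : Fin n → ℝ) (k : ℕ) {i j : Fin n} (hij : i ≠ j)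
    (hq : ∀ l, l ≠ i → l ≠ j → q l = p l) (hsum : q i + q j = p i + p j) :
    pbDiff q k - pbDiff p k = (q i * q j - p i * p j) * pairCoeff p k i j := by
  have hrest : ∏ l ∈ (univ.erase i).erase j, bernoulliGen (q l) =
      ∏ l ∈ (univ.erase i).erase j, bernoulliGen (p l) :=
    Finset.prod_congr rfl fun l hl => by
      simp only [mem_erase, mem_univ, and_true] at hl
      rw [hq l hl.2 hl.1]
  rw [pbDiff, pbDiff, pairCoeff, ← coeff_sub, ← coeff_C_mul, pbGen_eq_pair q hij,
    pbGen_eq_pair p hij, hrest]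
  congr 1
  have hC : (C (q i) + C (q j) : ℝ[X]) = C (p i) + C (p j) := by rw [← C_add, hsum, C_add]
  simp only [bernoulliGen, C_sub, C_mul]
  linear_combination ((1 - X) * (X - 1) *
    ∏ l ∈ (univ.erase i).erase j, (1 + C (p l) * (X - 1))) * hC

/-- The profile with the entries at `i` and `j` replaced. -/
def replacePair {n : ℕ} (p : Fin n → ℝ) (i j : Fin n) (s t : ℝ) : Fin n → ℝ :=
  Function.update (Function.update p i s) j t

lemma replacePair_left {n : ℕ} (p : Fin n → ℝ) {i j : Fin n} (hij : i ≠ j) (s t : ℝ) :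
    replacePair p i j s t i = s := by simp [replacePair, hij]

lemma replacePair_right {n : ℕ} (p : Fin n → ℝ) (i j : Fin n) (s t : ℝ) :
    replacePair p i j s t j = t := by simp [replacePair]

lemma replacePair_of_ne {n : ℕ} (p : Fin n → ℝ) {i j l : Fin n} (s t : ℝ) (hi : l ≠ i)
    (hj : l ≠ j) : replacePair p i j s t l = p l := by simp [replacePair, hi, hj]

lemma replacePair_mem {n : ℕ} {x : ℝ} {p : Fin n → ℝ} (hp : p ∈ boxSection x n) {i j : Fin n}
    (hij : i ≠ j) {s t : ℝ} (hs : 0 ≤ s ∧ s ≤ 1) (ht : 0 ≤ t ∧ t ≤ 1) (hst : s + t = p i + p j) :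
    replacePair p i j s t ∈ boxSection x n := by
  refine ⟨fun l => ?_, ?_⟩
  · by_cases hj : l = j
    · rw [hj, replacePair_right]; exact ht
    by_cases hi : l = i
    · rw [hi, replacePair_left p hij]; exact hs
    rw [replacePair_of_ne p s t hi hj]; exact hp.1 l
  · have hj : j ∈ (univ : Finset (Fin n)).erase i := mem_erase.2 ⟨hij.symm, mem_univ _⟩
    have h2 := hp.2
    rw [← Finset.add_sum_erase _ p (mem_univ i), ← Finset.add_sum_erase _ p hj] at h2
    rw [← Finset.add_sum_erase _ _ (mem_univ i), ← Finset.add_sum_erase _ _ hj,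
      replacePair_left p hij, replacePair_right,
      Finset.sum_congr rfl (g := p) fun l hl => ?_]
    · linarith
    · simp only [mem_erase, mem_univ, and_true] at hl
      exact replacePair_of_ne p s t hl.2 hl.1

lemma pbDiff_replacePair {n : ℕ} (p : Fin n → ℝ) (k : ℕ) {i j : Fin n} (hij : i ≠ j) {s t : ℝ}
    (hst : s + t = p i + p j) :
    pbDiff (replacePair p i j s t) k - pbDiff p k = (s * t - p i * p j) * pairCoeff p k i j := by
  have h := pbDiff_sub_of_pair p (replacePair p i j s t) k hij
    (fun l hi hj => replacePair_of_ne p s t hi hj)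
    (by rw [replacePair_left p hij, replacePair_right, hst])
  rwa [replacePair_left p hij, replacePair_right] at h

lemma pairCoeff_replacePair {n : ℕ} (p : Fin n → ℝ) (k : ℕ) (i j : Fin n) (s t : ℝ) :
    pairCoeff (replacePair p i j s t) k i j = pairCoeff p k i j := by
  unfold pairCoeff
  rw [Finset.prod_congr rfl fun l hl => ?_]
  simp only [mem_erase, mem_univ, and_true] at hl
  rw [replacePair_of_ne p s t hl.2 hl.1]

/-! ### Profiles with a single interior value -/

/-- The binomial probabilities. -/
lemma coeff_bernoulliGen_pow (a : ℝ) {m j : ℕ} (hj : j ≤ m) :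
    (bernoulliGen a ^ m).coeff j = a ^ j * (1 - a) ^ (m - j) * m.choose j := by
  rw [bernoulliGen_eq, add_pow, finsetSum_coeff, Finset.sum_eq_single j]
  · rw [mul_pow, ← C_pow, ← C_pow, ← C_eq_natCast, mul_assoc, mul_assoc, coeff_C_mul, ← C_mul,
      coeff_X_pow_mul', if_pos le_rfl, Nat.sub_self, coeff_C_zero, mul_assoc]
  · intro b _ hb
    rw [mul_pow, ← C_pow, ← C_pow, ← C_eq_natCast, mul_assoc, mul_assoc, coeff_C_mul, ← C_mul,
      mul_comm (X ^ b), coeff_C_mul, coeff_X_pow, if_neg hb.symm, mul_zero, mul_zero]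
  · intro h
    exact absurd (mem_range.2 (by omega)) h

/-- Successive binomial coefficients satisfy `C(m, j+1) (j+1) = C(m, j) (m-j)`. For `0 < a < 1` the
sign is thus that of `(m+1) a - (j+1)`; the factor `j + 1` avoids a division. -/
lemma binomial_diff (a : ℝ) {m j : ℕ} (hj : j + 1 ≤ m) :
    ((j : ℝ) + 1) * ((1 - X) * bernoulliGen a ^ m).coeff (j + 1) =
      m.choose j * a ^ j * (1 - a) ^ (m - (j + 1)) * ((m + 1) * a - (j + 1)) := by
  rw [coeff_one_sub_X_mul_succ, coeff_bernoulliGen_pow a hj, coeff_bernoulliGen_pow a (by omega),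
    show m - j = m - (j + 1) + 1 by omega]
  have h : (m.choose (j + 1) : ℝ) * (j + 1) = m.choose j * (m - j) := by
    have := Nat.choose_succ_right_eq m j
    rw [← Nat.cast_sub (by omega)]
    exact_mod_cast this
  rw [pow_succ, pow_succ]
  linear_combination (a ^ j * a * (1 - a) ^ (m - (j + 1))) * h

lemma pbGen_of_interior_eq {n : ℕ} (p : Fin n → ℝ) {a : ℝ}
    (h : ∀ i ∈ interiorIndices p, p i = a) :
    pbGen p = bernoulliGen a ^ #(interiorIndices p) * X ^ #{i | p i = 1} := by
  have hterm : ∀ i, bernoulliGen (p i) = (if p i ≠ 0 ∧ p i ≠ 1 then bernoulliGen a else 1) *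
      (if p i = 1 then X else 1) := fun i => by
    by_cases h1 : p i = 1
    · simp [h1, bernoulliGen_one]
    by_cases h0 : p i = 0
    · simp [h0, bernoulliGen_zero]
    · rw [if_pos ⟨h0, h1⟩, if_neg h1, mul_one, h i (by simp [interiorIndices, h0, h1])]
  simp only [pbGen, hterm, Finset.prod_mul_distrib, Finset.prod_ite, Finset.prod_const,
    one_pow, mul_one, interiorIndices]

lemma sum_of_interior_eq {n : ℕ} (p : Fin n → ℝ) {a : ℝ}
    (h : ∀ i ∈ interiorIndices p, p i = a) :
    ∑ i, p i = #(interiorIndices p) * a + #{i | p i = 1} := by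
  have hterm : ∀ i, p i = (if p i ≠ 0 ∧ p i ≠ 1 then a else 0) +
      (if p i = 1 then 1 else 0) := fun i => by
    by_cases h1 : p i = 1
    · simp [h1]
    by_cases h0 : p i = 0
    · simp [h0]
    · rw [if_pos ⟨h0, h1⟩, if_neg h1, add_zero, h i (by simp [interiorIndices, h0, h1])]
  rw [Finset.sum_congr rfl fun i _ => hterm i]
  simp only [Finset.sum_add_distrib, Finset.sum_ite, Finset.sum_const, interiorIndices,
    nsmul_eq_mul, mul_one, mul_zero, add_zero]

lemma card_interior_add_card_one_le {n : ℕ} (p : Fin n → ℝ) :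
    #(interiorIndices p) + #{i | p i = 1} ≤ n := by
  rw [← Finset.card_union_of_disjoint]
  · exact (Finset.card_le_univ _).trans (by simp)
  · rw [Finset.disjoint_left]
    intro i hi h1
    simp only [interiorIndices, mem_filter] at hi h1
    exact hi.2.2 h1.2

lemma exists_one_or_interior_of_card {n : ℕ} (p : Fin n → ℝ)
    (h : #(interiorIndices p) + #{i | p i = 1} = n) (i : Fin n) :
    p i = 1 ∨ i ∈ interiorIndices p := by
  have hd : Disjoint (interiorIndices p) ({i | p i = 1} : Finset (Fin n)) := by
    rw [Finset.disjoint_left]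
    intro i hi h1
    simp only [interiorIndices, mem_filter] at hi h1
    exact hi.2.2 h1.2
  rw [← Finset.card_union_of_disjoint hd] at h
  have hu : interiorIndices p ∪ ({i | p i = 1} : Finset (Fin n)) = univ :=
    Finset.eq_univ_of_card _ (by simpa using h)
  have := hu ▸ mem_univ i
  simp only [mem_union, mem_filter, mem_univ, true_and] at this
  exact this.symm

/-- The assertion for profiles with a single value besides `0` and `1`. -/
lemma pbDiff_pos_or_isHighLike_of_interior_eq {n k : ℕ} {x : ℝ} (hk : k ≤ n)
    (hx : (k : ℝ) - 1 / ((n : ℝ) - k + 2) ≤ x) (hx' : x < k + 1) {p : Fin n → ℝ}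
    (hp : p ∈ boxSection x n) {a : ℝ} (h : ∀ i ∈ interiorIndices p, p i = a) :
    0 < pbDiff p k ∨ IsHighLike k p := by
  have hgen := pbGen_of_interior_eq p h
  have hsum := hp.2
  rw [sum_of_interior_eq p h] at hsum
  have hle := card_interior_add_card_one_le p
  have hall := exists_one_or_interior_of_card p
  have hN : (2 : ℝ) ≤ (n : ℝ) - k + 2 := by
    have : (k : ℝ) ≤ n := by exact_mod_cast hk
    linarith
  have hN1 : 1 / ((n : ℝ) - k + 2) < 1 := by
    rw [div_lt_one (by linarith)]; linarith
  have ha : ∀ i ∈ interiorIndices p, 0 < a ∧ a < 1 := fun i hi => by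
    have hpi := hp.1 i
    rw [h i hi] at hpi
    have hi' := hi
    simp only [interiorIndices, mem_filter, mem_univ, true_and] at hi'
    rw [h i hi] at hi'
    exact ⟨lt_of_le_of_ne hpi.1 (Ne.symm hi'.1), lt_of_le_of_ne hpi.2 hi'.2⟩
  have hhigh : IsHighLike k p ↔
    (∀ i, p i = 1 ∨ p i = 1 / ((n : ℝ) - k + 2)) ∧ #{i | p i = 1} + 1 = k := Iff.rfl
  rw [hhigh]
  set m := #(interiorIndices p) with hm
  set r := #{i | p i = 1} with hr
  have hrk : r ≤ k := by
    have h0 : (0 : ℝ) ≤ m * a := by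
      rcases Nat.eq_zero_or_pos m with h0 | h0
      · simp [h0]
      · obtain ⟨i, hi⟩ := Finset.card_pos.1 h0
        exact mul_nonneg (Nat.cast_nonneg _) (ha i hi).1.le
    have : (r : ℝ) < k + 1 := by linarith
    exact Nat.lt_succ_iff.1 (by exact_mod_cast this)
  -- The `r` entries equal to 1 only shift the law, so the difference is a binomial one at index `j
  -- = k - r`.
  obtain ⟨j, rfl⟩ := Nat.exists_eq_add_of_le' hrk
  have hdiff : pbDiff p (j + r) = ((1 - X) * bernoulliGen a ^ m).coeff j := by
    rw [pbDiff, hgen, ← mul_assoc, coeff_mul_X_pow]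
  rw [hdiff]
  rcases Nat.eq_zero_or_pos m with h0 | hmpos
  · left
    rw [h0] at hsum ⊢
    have hj : j = 0 := by
      push_cast at hx hN1
      have : (j : ℝ) < 1 := by simp at hsum; linarith
      exact Nat.lt_one_iff.1 (by exact_mod_cast this)
    simp [hj]
  obtain ⟨i₀, hi₀⟩ := Finset.card_pos.1 hmpos
  obtain ⟨ha0, ha1⟩ := ha i₀ hi₀
  rcases Nat.eq_zero_or_pos j with rfl | hj
  · left
    rw [coeff_one_sub_X_mul_zero, coeff_bernoulliGen_pow a (Nat.zero_le _)]
    simpa using pow_pos (sub_pos.2 ha1) m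
  obtain ⟨l, rfl⟩ : ∃ l, j = l + 1 := ⟨j - 1, by omega⟩
  push_cast at hx hN hN1
  have hlm : l + 1 ≤ m := by
    have h1 : (m : ℝ) * a < m := mul_lt_of_lt_one_right (by exact_mod_cast hmpos) ha1
    have : (l : ℝ) < m := by linarith
    exact_mod_cast this
  have hbin := binomial_diff a hlm
  have hl0 : (0 : ℝ) < l + 1 := by positivity
  have hfac : 0 < (m.choose l : ℝ) * a ^ l * (1 - a) ^ (m - (l + 1)) := by
    have : 0 < m.choose l := Nat.choose_pos (by omega)
    have h1a := sub_pos.2 ha1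
    positivity
  by_cases hpos : 0 < ((m : ℝ) + 1) * a - (l + 1)
  · left
    have := mul_pos hfac hpos
    rw [← hbin] at this
    exact (mul_pos_iff_of_pos_left hl0).1 this
  right
  rw [not_lt] at hpos
  set N : ℝ := (n : ℝ) - (l + 1 + r) + 2 with hNdef
  have hc : (m : ℝ) + r ≤ n := by exact_mod_cast hle
  have hlm' : (l : ℝ) + 1 ≤ m := by exact_mod_cast hlm
  have hlr : (0 : ℝ) ≤ l := Nat.cast_nonneg _
  have hma : (l + 1 : ℝ) - 1 / N ≤ m * a := by linarith
  -- Combine `(m+1) a ≤ l + 1` with the lower bound on the mean, `m a ≥ l + 1 - 1/N`. Against `N ≥ m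
  -- - l + 1` this leaves `l (m - l) ≤ 0`, hence `l = 0` because `l < m`.
  have hNle : N * (l + 1) ≤ m + 1 := by
    have hN0 : 0 < N := by linarith
    have h1 : ((m : ℝ) + 1) * ((l + 1 : ℝ) - 1 / N) ≤ m * (l + 1) := by nlinarith
    have h2 : (l + 1 : ℝ) ≤ (m + 1) / N := by
      have : ((m : ℝ) + 1) * (1 / N) = (m + 1) / N := by ring
      nlinarith
    rwa [le_div_iff₀ hN0, mul_comm] at h2
  have hNge : (m : ℝ) - l + 1 ≤ N := by linarith
  have hl : l = 0 := by
    by_contra hl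
    have hl1 : (1 : ℝ) ≤ l := by exact_mod_cast Nat.one_le_iff_ne_zero.2 hl
    nlinarith
  subst hl
  simp only [Nat.cast_zero, zero_add] at *
  -- For `l = 0` the two bounds on `N` meet: no entry is 0, and `a` is squeezed to `1/N`.
  have hNm : N = m + 1 := by linarith
  have hn : m + r = n := by
    have : (m : ℝ) + r = n := by linarith
    exact_mod_cast this
  have ha' : a = 1 / N := by
    rw [hNm] at hma ⊢
    have hm1 : (0 : ℝ) < m + 1 := by positivity
    have hm0 : (0 : ℝ) < m := by exact_mod_cast hmpos
    refine le_antisymm ?_ ?_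
    · rw [le_div_iff₀ hm1]; linarith
    · have : (m : ℝ) * (1 / (m + 1)) = 1 - 1 / (m + 1) := by field_simp; ring
      rw [← this] at hma
      exact le_of_mul_le_mul_left hma hm0
  refine ⟨fun i => (hall hn i).imp_right fun hi => ?_, by omega⟩
  rw [h i hi, ha']
  push_cast
  simp [hNdef]

/-! ### The extremal profile: vanishing difference, positive slope -/

lemma coeff_bernoulliGen_pow_nonneg {a : ℝ} (h0 : 0 ≤ a) (h1 : a ≤ 1) (m j : ℕ) :
    0 ≤ (bernoulliGen a ^ m).coeff j := by
  simpa using (coeff_prod_bernoulliGen (univ : Finset (Fin m)) (p := fun _ => a)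
    fun _ => ⟨h0, h1⟩).1 j

lemma bernoulliGen_ne_zero (a : ℝ) : bernoulliGen a ≠ 0 := fun h => by
  have := congrArg (eval 1) h
  simp [bernoulliGen] at this

lemma highValue_bounds {n k : ℕ} (hk : k ≤ n) :
    0 < 1 / ((n : ℝ) - k + 2) ∧ 1 / ((n : ℝ) - k + 2) < 1 := by
  have : (k : ℝ) ≤ n := by exact_mod_cast hk
  refine ⟨one_div_pos.2 (by linarith), ?_⟩
  rw [div_lt_one (by linarith)]; linarith

lemma IsHighLike.interior {n k : ℕ} (hk : k ≤ n) {p : Fin n → ℝ} (hp : IsHighLike k p) :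
    (∀ i ∈ interiorIndices p, p i = 1 / ((n : ℝ) - k + 2)) ∧
      #(interiorIndices p) + #{i | p i = 1} = n := by
  obtain ⟨ha0, ha1⟩ := highValue_bounds hk
  refine ⟨fun i hi => ?_, ?_⟩
  · simp only [interiorIndices, mem_filter, mem_univ, true_and] at hi
    exact (hp.1 i).resolve_left hi.2
  · have : interiorIndices p = ({i | ¬ p i = 1} : Finset (Fin n)) := by
      ext i
      simp only [interiorIndices, mem_filter, mem_univ, true_and, and_iff_right_iff_imp]
      intro hi
      rw [(hp.1 i).resolve_left hi]
      exact ha0.ne'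
    rw [this, add_comm, Finset.card_filter_add_card_filter_not]
    simp

lemma IsHighLike.pbGen_eq {n k : ℕ} (hk : k ≤ n) {p : Fin n → ℝ} (hp : IsHighLike k p) :
    pbGen p = bernoulliGen (1 / ((n : ℝ) - k + 2)) ^ (n + 1 - k) * X ^ (k - 1) := by
  obtain ⟨h1, h2⟩ := hp.interior hk
  have h3 := hp.2
  rw [pbGen_of_interior_eq p h1, show #(interiorIndices p) = n + 1 - k by omega,
    show #{i | p i = 1} = k - 1 by omega]

lemma IsHighLike.pbDiff_eq_zero {n k : ℕ} (hk : k ≤ n) {p : Fin n → ℝ} (hp : IsHighLike k p) :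
    pbDiff p k = 0 := by
  have h3 := hp.2
  obtain ⟨l, rfl⟩ : ∃ l, k = 1 + l := ⟨k - 1, by omega⟩
  obtain ⟨m, rfl⟩ : ∃ m, n = l + 1 + m := ⟨n - l - 1, by omega⟩
  rw [pbDiff, hp.pbGen_eq hk, ← mul_assoc, show 1 + l - 1 = l by omega, coeff_mul_X_pow,
    show l + 1 + m + 1 - (1 + l) = m + 1 by omega]
  have := binomial_diff (1 / (((l + 1 + m : ℕ) : ℝ) - (1 + l : ℕ) + 2)) (show 0 + 1 ≤ m + 1 by omega)
  rw [Nat.cast_zero, zero_add, one_mul, zero_add] at this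
  rw [this]
  refine mul_eq_zero_of_right _ ?_
  have : ((l + 1 + m : ℕ) : ℝ) - (1 + l : ℕ) + 2 = m + 2 := by push_cast; ring
  rw [this]
  have : (m : ℝ) + 2 ≠ 0 := by positivity
  push_cast
  field_simp
  ring

/-- Deleting a 1 and one small entry leaves a shifted binomial law with coefficients `c₀, c₁, c₂,
…`. The slope is `c₂ - 3 c₁ + 3 c₀`, positive since `c₂ ≥ 0` and `(m+1) a < 1` gives `c₁ < c₀`. -/
lemma IsHighLike.pairCoeff_pos {n k : ℕ} (hk : k ≤ n) {p : Fin n → ℝ} (hp : IsHighLike k p)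
    {i j : Fin n} (hi : p i = 1) (hj : p j ≠ 1) : 0 < pairCoeff p k i j := by
  have hij : i ≠ j := by rintro rfl; exact hj hi
  have hcard : 0 < #{i | p i = 1} := Finset.card_pos.2 ⟨i, by simp [hi]⟩
  have h3 := hp.2
  obtain ⟨l, rfl⟩ : ∃ l, k = 2 + l := ⟨k - 2, by omega⟩
  obtain ⟨m, rfl⟩ : ∃ m, n = 2 + l + m := ⟨n - (2 + l), by omega⟩
  obtain ⟨ha0, ha1⟩ := highValue_bounds hk
  have hgen := hp.pbGen_eq hk
  rw [pbGen_eq_pair p hij, hi, (hp.1 j).resolve_left hj, bernoulliGen_one,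
    show 2 + l + m + 1 - (2 + l) = m + 1 by omega, show 2 + l - 1 = l + 1 by omega] at hgen
  have ha : ((2 + l + m : ℕ) : ℝ) - (2 + l : ℕ) + 2 = m + 2 := by push_cast; ring
  rw [ha] at hgen ha0 ha1
  set a : ℝ := 1 / ((m : ℝ) + 2) with hadef
  have hrest : ∏ l ∈ (univ.erase i).erase j, bernoulliGen (p l) = bernoulliGen a ^ m * X ^ l := by
    refine mul_left_cancel₀ (mul_ne_zero X_ne_zero (bernoulliGen_ne_zero a)) ?_
    rw [mul_assoc, hgen]
    ring
  rw [pairCoeff, hrest, show (1 - X) * ((X - 1) ^ 2 * (bernoulliGen a ^ m * X ^ l)) =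
    (1 - X) * ((1 - X) * ((1 - X) * bernoulliGen a ^ m)) * X ^ l by ring, coeff_mul_X_pow]
  have hone : ∀ P : ℝ[X], ((1 - X) * P).coeff 1 = P.coeff 1 - P.coeff 0 :=
    fun P => coeff_one_sub_X_mul_succ P 0
  have htwo : ∀ P : ℝ[X], ((1 - X) * P).coeff 2 = P.coeff 2 - P.coeff 1 :=
    fun P => coeff_one_sub_X_mul_succ P 1
  simp only [htwo, hone, coeff_one_sub_X_mul_zero]
  have hb2 := coeff_bernoulliGen_pow_nonneg ha0.le ha1.le m 2
  have hb01 : (bernoulliGen a ^ m).coeff (0 + 1) < (bernoulliGen a ^ m).coeff 0 := by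
    rcases Nat.eq_zero_or_pos m with h0 | hm
    · simp [h0, coeff_one]
    · have h := binomial_diff a (show 0 + 1 ≤ m from hm)
      rw [coeff_one_sub_X_mul_succ] at h
      have h1 : 0 < (1 - a) ^ (m - (0 + 1)) := pow_pos (by linarith) _
      have h2 : ((m : ℝ) + 1) * a - 1 < 0 := by
        have : ((m : ℝ) + 1) * a < 1 := by
          rw [hadef, mul_one_div, div_lt_one (by positivity)]; linarith
        linarith
      have h3 := mul_neg_of_pos_of_neg h1 h2
      simp only [Nat.choose_zero_right, Nat.cast_one, pow_zero, Nat.cast_zero, zero_add,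
        one_mul] at h h3 ⊢
      linarith
  simp only [zero_add] at *
  linarith

/-! ### Minimizers of the difference at fixed mean -/

/-- Minimizers of `pbDiff` do not see the product of two different interior values. -/
lemma pairCoeff_eq_zero_of_isMinOn {n k : ℕ} {x : ℝ} {p : Fin n → ℝ} (hp : p ∈ boxSection x n)
    (hmin : IsMinOn (pbDiff · k) (boxSection x n) p) {i j : Fin n} (hne : p i ≠ p j)
    {s t : ℝ} (hs : 0 ≤ s ∧ s ≤ 1) (ht : 0 ≤ t ∧ t ≤ 1) (hst : s + t = p i + p j)
    (hlt : s * t < p i * p j) : pairCoeff p k i j = 0 := by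
  have hij : i ≠ j := fun h => hne (h ▸ rfl)
  have h1 := isMinOn_iff.1 hmin _ (replacePair_mem hp hij hs ht hst)
  have hi := hp.1 i
  have hj := hp.1 j
  have hmid : 0 ≤ (p i + p j) / 2 ∧ (p i + p j) / 2 ≤ 1 := by constructor <;> linarith
  have h2 := isMinOn_iff.1 hmin _
    (replacePair_mem hp hij hmid hmid (by ring : (p i + p j) / 2 + (p i + p j) / 2 = p i + p j))
  have e1 := pbDiff_replacePair p k hij hst
  have e2 := pbDiff_replacePair p k hij
    (by ring : (p i + p j) / 2 + (p i + p j) / 2 = p i + p j)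
  have hsq : 0 < (p i + p j) / 2 * ((p i + p j) / 2) - p i * p j := by
    have := sq_pos_of_ne_zero (sub_ne_zero.2 hne)
    nlinarith
  refine le_antisymm ?_ ?_
  -- A positive slope would make lowering the product profitable; a negative one, averaging the two
  -- entries.
  · by_contra! h
    nlinarith [mul_pos (sub_pos.2 hlt) h]
  · by_contra! h
    nlinarith [mul_pos hsq (neg_pos.2 h)]

/-- Induction on the number of interior entries: a push to the boundary preserves minimality and
removes at least one of them. -/
lemma pbDiff_pos_or_isHighLike_of_isMinOn {n k : ℕ} {x : ℝ} (hk : k ≤ n)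
    (hx : (k : ℝ) - 1 / ((n : ℝ) - k + 2) ≤ x) (hx' : x < k + 1) (N : ℕ) :
    ∀ p ∈ boxSection x n, IsMinOn (pbDiff · k) (boxSection x n) p → #(interiorIndices p) ≤ N →
      0 < pbDiff p k ∨ IsHighLike k p := by
  induction N with
  | zero =>
    intro p hp _ hN
    refine pbDiff_pos_or_isHighLike_of_interior_eq hk hx hx' hp (a := 0) fun i hi => ?_
    rw [Finset.card_eq_zero.1 (Nat.le_zero.1 hN)] at hi
    simp at hi
  | succ N ih =>
    intro p hp hmin hN
    by_cases hall : ∀ i ∈ interiorIndices p, ∀ j ∈ interiorIndices p, p i = p j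
    · rcases (interiorIndices p).eq_empty_or_nonempty with he | ⟨i₀, hi₀⟩
      · exact pbDiff_pos_or_isHighLike_of_interior_eq hk hx hx' hp (a := 0)
          fun i hi => by simp [he] at hi
      · exact pbDiff_pos_or_isHighLike_of_interior_eq hk hx hx' hp fun i hi => hall i hi i₀ hi₀
    push Not at hall
    obtain ⟨i, hi, j, hj, hne⟩ := hall
    have hij : i ≠ j := fun h => hne (h ▸ rfl)
    have hbi := hp.1 i
    have hbj := hp.1 j
    have hi' := hi
    have hj' := hj
    simp only [interiorIndices, mem_filter, mem_univ, true_and] at hi' hj'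
    have hi0 : 0 < p i := lt_of_le_of_ne hbi.1 hi'.1.symm
    have hi1 : p i < 1 := lt_of_le_of_ne hbi.2 hi'.2
    have hj0 : 0 < p j := lt_of_le_of_ne hbj.1 hj'.1.symm
    have hj1 : p j < 1 := lt_of_le_of_ne hbj.2 hj'.2
    -- Concentrate the mass of the pair until one entry hits 0 (sum at most 1) or 1 (sum above 1).
    -- In the second case `t ≠ 1` is kept for the slope argument.
    obtain ⟨s, t, hs, ht, hst, hlt, hs01⟩ : ∃ s t : ℝ, (0 ≤ s ∧ s ≤ 1) ∧ (0 ≤ t ∧ t ≤ 1) ∧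
        s + t = p i + p j ∧ s * t < p i * p j ∧ (s = 0 ∨ s = 1 ∧ t ≠ 1) := by
      rcases le_or_gt (p i + p j) 1 with h | h
      · exact ⟨0, p i + p j, by simp, ⟨by linarith, h⟩, by ring, by nlinarith, Or.inl rfl⟩
      · refine ⟨1, p i + p j - 1, by simp, ⟨by linarith, by linarith⟩, by ring, by nlinarith,
          Or.inr ⟨rfl, fun h => by linarith⟩⟩
    have hc := pairCoeff_eq_zero_of_isMinOn hp hmin hne hs ht hst hlt
    set q := replacePair p i j s t with hq
    have hqi : q i = s := replacePair_left p hij s t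
    have hqj : q j = t := replacePair_right p i j s t
    have heq : pbDiff q k = pbDiff p k := by
      have := pbDiff_replacePair p k hij hst
      rw [hc, mul_zero] at this
      exact sub_eq_zero.1 this
    have hqmem : q ∈ boxSection x n := replacePair_mem hp hij hs ht hst
    have hqmin : IsMinOn (pbDiff · k) (boxSection x n) q :=
      isMinOn_iff.2 fun r hr => heq.trans_le (isMinOn_iff.1 hmin r hr)
    have hsub : interiorIndices q ⊆ (interiorIndices p).erase i := by
      intro l hl
      rw [mem_erase]
      have hl' := hl
      simp only [interiorIndices, mem_filter, mem_univ, true_and] at hl'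
      have hli : l ≠ i := by
        rintro rfl
        rw [hqi] at hl'
        rcases hs01 with h | h
        · exact hl'.1 h
        · exact hl'.2 h.1
      refine ⟨hli, ?_⟩
      by_cases hlj : l = j
      · exact hlj ▸ hj
      · rw [hq, replacePair_of_ne p s t hli hlj] at hl'
        simpa [interiorIndices] using hl'
    have hcard := Finset.card_le_card hsub
    rw [Finset.card_erase_of_mem hi] at hcard
    rcases ih q hqmem hqmin (by omega) with h | h
    · exact Or.inl (heq ▸ h)
    exfalso
    -- A pushed profile is never extremal: extremal profiles have no zero entry, and at a pair with
    -- exactly one 1 their slope is positive, whereas here it is 0.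
    rcases hs01 with h0 | ⟨h1, ht1⟩
    · rcases h.1 i with h' | h' <;> rw [hqi, h0] at h'
      · exact zero_ne_one h'
      · exact (highValue_bounds hk).1.ne h'
    · have := h.pairCoeff_pos hk (hqi.trans h1) (hqj.trans_ne ht1)
      rw [hq, pairCoeff_replacePair, hc] at this
      exact this.false

/-- By compactness a minimizer exists, and its value is either positive or 0. If the difference at
`p` is not positive, `p` is itself a minimizer, and the classification applies to it directly. -/
theorem pbDiff_pos_or_isHighLike {n k : ℕ} {p : Fin n → ℝ} (hp : ∀ i, 0 ≤ p i ∧ p i ≤ 1)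
    (hk : k ≤ n) (hx : (k : ℝ) - 1 / ((n : ℝ) - k + 2) ≤ pbMean p) (hx' : pbMean p < k + 1) :
    0 < pbDiff p k ∨ IsHighLike k p := by
  have hmem : p ∈ boxSection (pbMean p) n := ⟨hp, (pbMean_eq_sum p).symm⟩
  obtain ⟨q, hq, hqmin⟩ := (isCompact_boxSection (pbMean p) n).exists_isMinOn ⟨p, hmem⟩
    (continuous_pbDiff k).continuousOn
  have hqp := isMinOn_iff.1 hqmin p hmem
  have hN := pbDiff_pos_or_isHighLike_of_isMinOn hk hx hx'
  rcases hN _ q hq hqmin le_rfl with h | h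
  · exact Or.inl (h.trans_le hqp)
  by_cases hpos : 0 < pbDiff p k
  · exact Or.inl hpos
  refine hN _ p hmem (isMinOn_iff.2 fun r hr => ?_) le_rfl
  exact (not_lt.1 hpos).trans ((h.pbDiff_eq_zero hk).symm.le.trans (isMinOn_iff.1 hqmin r hr))

/-! ### Ordered profiles and the reflected sign statement -/

lemma IsHighLike.eq_highProfile {n k : ℕ} {p : Fin n → ℝ} (hanti : Antitone p)
    (hle : ∀ i, p i ≤ 1) (hp : IsHighLike k p) : p = highProfile k n := by
  have hcard := hp.2
  funext i
  unfold highProfile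
  split_ifs with hi
  · by_contra hne
    have hsub : ({l | p l = 1} : Finset (Fin n)) ⊆ Finset.Iio i := fun l hl => by
      simp only [mem_filter, mem_univ, true_and, mem_Iio] at hl ⊢
      by_contra! h
      exact hne (le_antisymm (hle i) (hl ▸ hanti h))
    have := Finset.card_le_card hsub
    rw [Fin.card_Iio] at this
    omega
  · refine (hp.1 i).resolve_left fun h1 => ?_
    have hsub : Finset.Iic i ⊆ ({l | p l = 1} : Finset (Fin n)) := fun l hl => by
      simp only [mem_filter, mem_univ, true_and, mem_Iic] at hl ⊢
      exact le_antisymm (hle l) (h1 ▸ hanti hl)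
    have := Finset.card_le_card hsub
    rw [Fin.card_Iic] at this
    omega

lemma pbDiff_pos_or_eq_highProfile {n k : ℕ} {p : Fin n → ℝ} (hp : p ∈ successSimplex n)
    (hk : k ≤ n) (hx : (k : ℝ) - 1 / ((n : ℝ) - k + 2) ≤ pbMean p) (hx' : pbMean p < k + 1) :
    0 < pbDiff p k ∨ 1 ≤ k ∧ p = highProfile k n :=
  (pbDiff_pos_or_isHighLike hp.2 hk hx hx').imp_right fun h =>
    ⟨by have := h.2; omega, h.eq_highProfile hp.1 fun i => (hp.2 i).2⟩

lemma reflectProfile_reflectProfile {n : ℕ} (p : Fin n → ℝ) :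
    reflectProfile (reflectProfile p) = p := by
  funext i; simp [reflectProfile]

lemma reflectProfile_highProfile {n k : ℕ} (hk : k ≤ n) :
    reflectProfile (highProfile (n - k) n) = lowProfile (k + 1) n := by
  funext i
  have hi := i.2
  simp only [reflectProfile, highProfile, lowProfile, Fin.val_rev]
  rw [Nat.cast_sub hk]
  by_cases h : (i : ℕ) < k + 1
  · rw [if_neg (by omega), if_pos h]
    push_cast
    have : (k : ℝ) + 1 + 1 ≠ 0 := by positivity
    rw [show (n : ℝ) - (n - k) + 2 = k + 1 + 1 by ring]
    field_simp
    ring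
  · rw [if_pos (by omega), if_neg h, sub_self]

lemma pbProb_succ_lt_or_eq_lowProfile {n k : ℕ} {p : Fin n → ℝ} (hp : p ∈ successSimplex n)
    (hk : k ≤ n) (hx : (k : ℝ) - 1 < pbMean p) (hx' : pbMean p ≤ k + 1 / ((k : ℝ) + 2)) :
    pbProb p (k + 1) < pbProb p k ∨ k < n ∧ p = lowProfile (k + 1) n := by
  have hmean := pbMean_reflectProfile p
  have h := pbDiff_pos_or_eq_highProfile (reflectProfile_mem hp) (Nat.sub_le n k)
    (by
      rw [hmean, Nat.cast_sub hk, show (n : ℝ) - (n - k) + 2 = k + 2 by ring]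
      linarith)
    (by rw [hmean, Nat.cast_sub hk]; linarith)
  rcases h with h | h
  · left
    -- For `k = n` the reflected index is 0, where the convention `f(-1) = 0` matches `f(n+1) = 0`.
    rcases Nat.eq_zero_or_pos (n - k) with h0 | h0
    · obtain rfl : k = n := by omega
      rw [h0, pbDiff_zero, pbProb_reflectProfile p (show 0 + k = k by omega)] at h
      rwa [pbProb_eq_zero_of_lt p (Nat.lt_succ_self k)]
    · obtain ⟨l, hl⟩ : ∃ l, n - k = l + 1 := ⟨n - k - 1, by omega⟩
      rw [hl, pbDiff_succ, pbProb_reflectProfile p (show l + 1 + k = n by omega),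
        pbProb_reflectProfile p (show l + (k + 1) = n by omega)] at h
      linarith
  · right
    refine ⟨by omega, ?_⟩
    rw [← reflectProfile_highProfile hk, ← h.2, reflectProfile_reflectProfile]

/-! ### Two-valued profiles and the two extremal ones -/

/-- The profile `(u, …, u, v, …, v)` with `r` entries equal to `u`. -/
noncomputable def stepProfile (r n : ℕ) (u v : ℝ) : Fin n → ℝ :=
  fun i => if (i : ℕ) < r then u else v

lemma stepProfile_mem {r n : ℕ} {u v : ℝ} (hv : 0 ≤ v) (huv : v ≤ u) (hu : u ≤ 1) :
    stepProfile r n u v ∈ successSimplex n := by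
  refine ⟨fun i j hij => ?_, fun i => ?_⟩ <;> unfold stepProfile
  · have : (i : ℕ) ≤ j := hij
    split_ifs <;> first | exact le_rfl | exact huv | omega
  · split_ifs <;> constructor <;> linarith

lemma card_filter_val_lt {r n : ℕ} (hr : r ≤ n) : #{i : Fin n | (i : ℕ) < r} = r := by
  rw [Fin.card_filter_val_lt]; omega

lemma card_filter_not_val_lt {r n : ℕ} (hr : r ≤ n) : #{i : Fin n | ¬ (i : ℕ) < r} = n - r := by
  have := Finset.card_filter_add_card_filter_not (s := univ) fun i : Fin n => (i : ℕ) < r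
  rw [card_filter_val_lt hr, Finset.card_univ, Fintype.card_fin] at this
  omega

lemma pbMean_stepProfile {r n : ℕ} (hr : r ≤ n) (u v : ℝ) :
    pbMean (stepProfile r n u v) = r * u + ((n : ℝ) - r) * v := by
  rw [pbMean_eq_sum]
  simp only [stepProfile, Finset.sum_ite, Finset.sum_const, card_filter_val_lt hr,
    card_filter_not_val_lt hr, nsmul_eq_mul, Nat.cast_sub hr]

lemma pbGen_stepProfile {r n : ℕ} (hr : r ≤ n) (u v : ℝ) :
    pbGen (stepProfile r n u v) = bernoulliGen u ^ r * bernoulliGen v ^ (n - r) := by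
  simp only [pbGen, stepProfile, apply_ite bernoulliGen, Finset.prod_ite, Finset.prod_const,
    card_filter_val_lt hr, card_filter_not_val_lt hr]

lemma pbDiff_stepProfile_zero {l n : ℕ} (hl : l + 1 ≤ n) (u : ℝ) :
    pbDiff (stepProfile (l + 1) n u 0) (l + 1) = u ^ l * ((l + 2) * u - (l + 1)) := by
  rw [pbDiff, pbGen_stepProfile hl, bernoulliGen_zero, one_pow, mul_one]
  have h := binomial_diff u (le_refl (l + 1))
  have h0 : (l : ℝ) + 1 ≠ 0 := by positivity
  refine mul_left_cancel₀ h0 (h.trans ?_)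
  rw [Nat.choose_succ_self_right, Nat.sub_self]
  push_cast
  ring

lemma pbDiff_stepProfile_one {l m n : ℕ} (hn : l + 1 + m = n) (v : ℝ) :
    pbDiff (stepProfile l n 1 v) (l + 1) = (1 - v) ^ m * ((m + 2) * v - 1) := by
  rw [pbDiff, pbGen_stepProfile (by omega), bernoulliGen_one, mul_comm (X ^ l), ← mul_assoc,
    add_comm l 1, coeff_mul_X_pow, show n - l = m + 1 by omega]
  have h := binomial_diff v (show 0 + 1 ≤ m + 1 by omega)
  simp only [Nat.cast_zero, zero_add, one_mul, Nat.choose_zero_right, Nat.cast_one, pow_zero,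
    Nat.add_sub_cancel] at h
  rw [h]
  push_cast
  ring

lemma highProfile_eq_stepProfile (l n : ℕ) :
    highProfile (l + 1) n = stepProfile l n 1 (1 / ((n : ℝ) - (l + 1 : ℕ) + 2)) := by
  funext i; simp [highProfile, stepProfile]

lemma lowProfile_eq_stepProfile (k n : ℕ) :
    lowProfile k n = stepProfile k n ((k : ℝ) / (k + 1)) 0 := rfl

lemma highProfile_mem {k n : ℕ} (hk1 : 1 ≤ k) (hk : k ≤ n) :
    highProfile k n ∈ successSimplex n := by
  obtain ⟨l, rfl⟩ : ∃ l, k = l + 1 := ⟨k - 1, by omega⟩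
  obtain ⟨h0, h1⟩ := highValue_bounds hk
  rw [highProfile_eq_stepProfile]
  exact stepProfile_mem h0.le h1.le le_rfl

lemma lowProfile_mem (k n : ℕ) : lowProfile k n ∈ successSimplex n := by
  rw [lowProfile_eq_stepProfile]
  refine stepProfile_mem le_rfl (by positivity) ?_
  rw [div_le_one (by positivity)]; linarith

lemma pbMean_highProfile {k n : ℕ} (hk1 : 1 ≤ k) (hk : k ≤ n) :
    pbMean (highProfile k n) = k - 1 / ((n : ℝ) - k + 2) := by
  obtain ⟨l, rfl⟩ : ∃ l, k = l + 1 := ⟨k - 1, by omega⟩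
  obtain ⟨m, rfl⟩ := Nat.exists_eq_add_of_le hk
  rw [highProfile_eq_stepProfile, pbMean_stepProfile (by omega)]
  push_cast
  rw [show (l : ℝ) + 1 + m - (l + 1) + 2 = m + 2 by ring]
  have : (m : ℝ) + 2 ≠ 0 := by positivity
  field_simp
  ring

lemma pbMean_lowProfile {k n : ℕ} (hk : k ≤ n) :
    pbMean (lowProfile k n) = k - 1 + 1 / ((k : ℝ) + 1) := by
  rw [lowProfile_eq_stepProfile, pbMean_stepProfile hk]
  have : (k : ℝ) + 1 ≠ 0 := by positivity
  field_simp
  ring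

lemma pbDiff_highProfile {k n : ℕ} (hk1 : 1 ≤ k) (hk : k ≤ n) :
    pbDiff (highProfile k n) k = 0 := by
  obtain ⟨l, rfl⟩ : ∃ l, k = l + 1 := ⟨k - 1, by omega⟩
  obtain ⟨m, rfl⟩ := Nat.exists_eq_add_of_le hk
  rw [highProfile_eq_stepProfile, pbDiff_stepProfile_one rfl]
  push_cast
  rw [show (l : ℝ) + 1 + m - (l + 1) + 2 = m + 2 by ring]
  have : (m : ℝ) + 2 ≠ 0 := by positivity
  rw [mul_one_div_cancel this, sub_self, mul_zero]

lemma pbDiff_lowProfile {k n : ℕ} (hk1 : 1 ≤ k) (hk : k ≤ n) :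
    pbDiff (lowProfile k n) k = 0 := by
  obtain ⟨l, rfl⟩ : ∃ l, k = l + 1 := ⟨k - 1, by omega⟩
  rw [lowProfile_eq_stepProfile, pbDiff_stepProfile_zero hk]
  push_cast
  have : (l : ℝ) + 1 + 1 ≠ 0 := by positivity
  field_simp
  ring

lemma highMean_lt {k n : ℕ} (hk : k ≤ n) : (k : ℝ) - 1 / ((n : ℝ) - k + 2) < k := by
  linarith [(highValue_bounds hk).1]

lemma lt_highMean {k n : ℕ} (hk : k ≤ n) : (k : ℝ) - 1 < k - 1 / ((n : ℝ) - k + 2) := by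
  linarith [(highValue_bounds hk).2]

lemma one_div_add_two_pos (k : ℕ) : 0 < 1 / ((k : ℝ) + 2) := by positivity

lemma one_div_add_two_lt (k : ℕ) : 1 / ((k : ℝ) + 2) < 1 := by
  have : (0 : ℝ) ≤ k := Nat.cast_nonneg k
  rw [div_lt_one (by positivity)]; linarith

lemma pbMean_lowProfile_succ {k n : ℕ} (hk : k < n) :
    pbMean (lowProfile (k + 1) n) = k + 1 / ((k : ℝ) + 2) := by
  rw [pbMean_lowProfile hk]
  push_cast
  rw [add_sub_cancel_right, add_assoc, one_add_one_eq_two]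

/-! ### The mode as a function of the mean -/

/-- In the closed definite region the mode is a singleton away from the extremal profiles. -/
lemma pbMode_eq_singleton_of_mean {n k : ℕ} {p : Fin n → ℝ} (hp : p ∈ successSimplex n)
    (hk : k ≤ n) (hx : (k : ℝ) - 1 / ((n : ℝ) - k + 2) ≤ pbMean p)
    (hx' : pbMean p ≤ k + 1 / ((k : ℝ) + 2)) (hhigh : 1 ≤ k → p ≠ highProfile k n)
    (hlow : k < n → p ≠ lowProfile (k + 1) n) : pbMode p = {k} := by
  refine pbMode_eq_singleton hp.2 ?_ ?_
  · exact (pbDiff_pos_or_eq_highProfile hp hk hx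
      (by linarith [one_div_add_two_lt k])).resolve_right fun h => hhigh h.1 h.2
  · exact (pbProb_succ_lt_or_eq_lowProfile hp hk
      (by linarith [lt_highMean hk]) hx').resolve_right fun h => hlow h.1 h.2

/-- Between two consecutive integers, the mode can only be at these integers. -/
lemma pbDiff_pos_and_pbProb_lt {n l : ℕ} {p : Fin n → ℝ} (hp : p ∈ successSimplex n)
    (hl : l + 1 ≤ n) (hx : (l : ℝ) < pbMean p) (hx' : pbMean p < l + 1) :
    0 < pbDiff p l ∧ pbProb p (l + 1 + 1) < pbProb p (l + 1) := by
  have h1 := highMean_lt (show l ≤ n by omega)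
  constructor
  · refine (pbDiff_pos_or_eq_highProfile hp (by omega) (by linarith) hx').resolve_right ?_
    rintro ⟨h, rfl⟩
    rw [pbMean_highProfile h (by omega)] at hx
    linarith
  · have h2 := one_div_add_two_pos (l + 1)
    refine (pbProb_succ_lt_or_eq_lowProfile hp hl (by push_cast; linarith)
      (by push_cast at h2 ⊢; linarith)).resolve_right ?_
    rintro ⟨h, rfl⟩
    rw [pbMean_lowProfile_succ h] at hx'
    push_cast at hx' h2
    linarith

lemma pbMode_of_mean_between {n l : ℕ} {p : Fin n → ℝ} (hp : p ∈ successSimplex n)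
    (hl : l + 1 ≤ n) (hx : (l : ℝ) < pbMean p) (hx' : pbMean p < l + 1) :
    (pbDiff p (l + 1) < 0 → pbMode p = {l}) ∧ (0 < pbDiff p (l + 1) → pbMode p = {l + 1}) ∧
      (pbDiff p (l + 1) = 0 → pbMode p = {l, l + 1}) := by
  obtain ⟨h1, h2⟩ := pbDiff_pos_and_pbProb_lt hp hl hx hx'
  refine ⟨fun h => pbMode_eq_singleton hp.2 h1 ?_, fun h => pbMode_eq_singleton hp.2 h h2,
    fun h => pbMode_eq_pair hp.2 h1 ?_ h2⟩
  · rw [pbDiff_succ] at h; linarith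
  · rw [pbDiff_succ] at h; linarith

lemma mem_bifurcationSet {n l : ℕ} {p : Fin n → ℝ} (hp : p ∈ successSimplex n)
    (hl : l + 1 ≤ n) (hx : (l : ℝ) < pbMean p) (hx' : pbMean p < l + 1)
    (h : pbDiff p (l + 1) = 0) : p ∈ bifurcationSet (l + 1) n := by
  obtain ⟨h1, -⟩ := pbDiff_pos_and_pbProb_lt hp hl hx hx'
  have hpos := pbProb_pos_of_pbDiff_pos hp.2 h1
  rw [pbDiff_succ, sub_eq_zero] at h
  exact ⟨hp, by omega, h.symm, h ▸ hpos⟩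

/-! ### Bounds for the mean on the bifurcation sets -/

lemma pbMean_le_of_mem_bifurcationSet {n k : ℕ} (hk : k ≤ n) {p : Fin n → ℝ}
    (hp : p ∈ bifurcationSet k n) : pbMean p ≤ k - 1 / ((n : ℝ) - k + 2) := by
  obtain ⟨hs, hk1, heq, hpos⟩ := hp
  obtain ⟨l, rfl⟩ : ∃ l, k = l + 1 := ⟨k - 1, by omega⟩
  rw [Nat.add_sub_cancel] at heq
  by_contra! hgt
  rcases lt_or_ge (pbMean p) ((l + 1 : ℕ) + 1) with hlt | hge
  · rcases pbDiff_pos_or_eq_highProfile hs hk hgt.le hlt with h | ⟨_, rfl⟩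
    · rw [pbDiff_succ] at h; linarith
    · exact hgt.ne (pbMean_highProfile hk1 hk).symm
  -- For a mean of at least `k + 1`, apply the sign statement at its integer part `J > k`. A rise at
  -- `J` contradicts `f(k-1) = f(k) > 0`, after which `f` is nonincreasing; the exceptional profile
  -- has mean below `J`.
  have h0 : 0 ≤ pbMean p := le_trans (by positivity) hge
  obtain ⟨j, hj⟩ : ∃ j, ⌊pbMean p⌋₊ = j + 1 + (l + 1) := by
    have : l + 1 + 1 ≤ ⌊pbMean p⌋₊ := Nat.le_floor (by exact_mod_cast hge)
    exact ⟨⌊pbMean p⌋₊ - (l + 1) - 1, by omega⟩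
  have hfl := Nat.floor_le h0
  have hfl' := Nat.lt_floor_add_one (pbMean p)
  rw [hj] at hfl hfl'
  have hjn : j + 1 + (l + 1) ≤ n := by
    have : pbMean p ≤ n := by
      rw [pbMean_eq_sum]
      exact (Finset.sum_le_card_nsmul univ p 1 fun i _ => (hs.2 i).2).trans (by simp)
    exact_mod_cast hfl.trans this
  rcases pbDiff_pos_or_eq_highProfile hs hjn ((highMean_lt hjn).le.trans hfl) hfl' with h | ⟨h1, h⟩
  · rw [show j + 1 + (l + 1) = j + (l + 1) + 1 by ring, pbDiff_succ] at h
    have := pbProb_le_of_ge hs.2 heq.ge (heq ▸ hpos) (show l + 1 ≤ j + (l + 1) by omega)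
    linarith
  · have := highMean_lt hjn
    rw [← pbMean_highProfile h1 hjn, ← h] at this
    linarith

/-- Reflection exchanges the bifurcation sets of `k` and `n - k + 1`, turning the upper bound into
this one. -/
lemma le_pbMean_of_mem_bifurcationSet {n k : ℕ} (hk : k ≤ n) {p : Fin n → ℝ}
    (hp : p ∈ bifurcationSet k n) : k - 1 + 1 / ((k : ℝ) + 1) ≤ pbMean p := by
  obtain ⟨hs, hk1, heq, hpos⟩ := hp
  have hmem : reflectProfile p ∈ bifurcationSet (n - k + 1) n := by
    have h1 := pbProb_reflectProfile p (show n - k + 1 - 1 + k = n by omega)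
    have h2 := pbProb_reflectProfile p (show n - k + 1 + (k - 1) = n by omega)
    refine ⟨reflectProfile_mem hs, by omega, ?_, ?_⟩
    · rw [h1, h2, heq]
    · rwa [h2, heq]
  have h := pbMean_le_of_mem_bifurcationSet (by omega) hmem
  rw [pbMean_reflectProfile] at h
  push_cast [Nat.cast_sub hk] at h
  rw [show (n : ℝ) - (n - k + 1) + 2 = k + 1 by ring] at h
  linarith

/-! ### Witnesses in the ambiguous band -/

/-- Spread the mean evenly over the first `l + 1` entries. The sign is that of `(l+2) x / (l+1) -
(l+1)`, which changes exactly at `x = l + 1/(l+2)`. -/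
lemma exists_pbDiff_pos {n l : ℕ} (hl : l + 1 ≤ n) {x : ℝ} (hx : (l : ℝ) + 1 / (l + 2) < x)
    (hx' : x ≤ l + 1) : ∃ p ∈ successSimplex n, pbMean p = x ∧ 0 < pbDiff p (l + 1) := by
  have h0 : (0 : ℝ) < l + 1 := by positivity
  have h2 : (0 : ℝ) < l + 2 := by positivity
  have hlt : (l : ℝ) + 1 < (l + 2) * (x / (l + 1)) := by
    have hx1 := mul_lt_mul_of_pos_right hx h2
    rw [add_mul, one_div_mul_cancel h2.ne'] at hx1
    rw [← mul_div_assoc, lt_div_iff₀ h0]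
    linarith
  have hu : 0 < x / (l + 1) := by
    by_contra! h
    nlinarith
  refine ⟨stepProfile (l + 1) n (x / (l + 1)) 0, stepProfile_mem le_rfl hu.le ?_, ?_, ?_⟩
  · rwa [div_le_one h0]
  · rw [pbMean_stepProfile hl]
    push_cast
    field_simp
    ring
  · rw [pbDiff_stepProfile_zero hl]
    exact mul_pos (pow_pos hu l) (sub_pos.2 hlt)

/-- Take `l` ones and spread the remaining mean `x - l` evenly over all other entries; the upper
bound on `x` says exactly `(m+2) v < 1`. -/
lemma exists_pbDiff_neg {n l : ℕ} (hl : l + 1 ≤ n) {x : ℝ} (hx : (l : ℝ) ≤ x)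
    (hx' : x < (l + 1 : ℕ) - 1 / ((n : ℝ) - (l + 1 : ℕ) + 2)) :
    ∃ p ∈ successSimplex n, pbMean p = x ∧ pbDiff p (l + 1) < 0 := by
  obtain ⟨m, rfl⟩ := Nat.exists_eq_add_of_le hl
  push_cast at hx'
  rw [show (l : ℝ) + 1 + m - (l + 1) + 2 = m + 2 by ring] at hx'
  have h0 : (0 : ℝ) < m + 1 := by positivity
  have h2 : (0 : ℝ) < m + 2 := by positivity
  set v := (x - l) / (m + 1) with hv
  have hv0 : 0 ≤ v := div_nonneg (by linarith) h0.le
  have hmul : (m + 1) * v = x - l := by rw [hv]; field_simp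
  have hlt : (m + 2) * v < 1 := by
    have hx1 := mul_lt_mul_of_pos_right hx' h2
    rw [sub_mul, one_div_mul_cancel h2.ne'] at hx1
    by_contra! h
    nlinarith
  have hv1 : v < 1 := by
    by_contra! h
    nlinarith [(Nat.cast_nonneg m : (0 : ℝ) ≤ m)]
  refine ⟨stepProfile l _ 1 v, stepProfile_mem hv0 hv1.le le_rfl, ?_, ?_⟩
  · rw [pbMean_stepProfile (by omega)]
    push_cast
    linarith
  · rw [pbDiff_stepProfile_one rfl]
    exact mul_neg_of_pos_of_neg (pow_pos (sub_pos.2 hv1) m) (by linarith)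

lemma convex_successSimplex (n : ℕ) : Convex ℝ (successSimplex n) := by
  intro p hp q hq a b ha hb hab
  refine ⟨fun i j hij => ?_, fun i => ?_⟩ <;>
    simp only [Pi.add_apply, Pi.smul_apply, smul_eq_mul]
  · have h1 := mul_le_mul_of_nonneg_left (hp.1 hij) ha
    have h2 := mul_le_mul_of_nonneg_left (hq.1 hij) hb
    linarith
  · have h1 := mul_le_mul_of_nonneg_left (hp.2 i).2 ha
    have h2 := mul_le_mul_of_nonneg_left (hq.2 i).2 hb
    exact ⟨add_nonneg (mul_nonneg ha (hp.2 i).1) (mul_nonneg hb (hq.2 i).1), by linarith⟩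

lemma convex_meanSection (x : ℝ) (n : ℕ) : Convex ℝ (meanSection x n) := by
  intro p hp q hq a b ha hb hab
  refine ⟨convex_successSimplex n hp.1 hq.1 ha hb hab, ?_⟩
  have h1 := hp.2
  have h2 := hq.2
  rw [pbMean_eq_sum] at h1 h2 ⊢
  simp only [Pi.add_apply, Pi.smul_apply, smul_eq_mul, Finset.sum_add_distrib,
    ← Finset.mul_sum, h1, h2]
  rw [← add_mul, hab, one_mul]

lemma exists_pbDiff_eq_zero {n k : ℕ} {x : ℝ} {p q : Fin n → ℝ} (hp : p ∈ meanSection x n)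
    (hq : q ∈ meanSection x n) (hpk : pbDiff p k < 0) (hqk : 0 < pbDiff q k) :
    ∃ r ∈ meanSection x n, pbDiff r k = 0 :=
  (convex_meanSection x n).isPreconnected.intermediate_value hp hq
    (continuous_pbDiff k).continuousOn ⟨hpk.le, hqk.le⟩

end

theorem mainTheorem7 (n : ℕ) :
    -- extreme values of the mean on the bifurcation sets
    (∀ k : ℕ, 1 ≤ k → k ≤ n →
      IsLeast (pbMean '' bifurcationSet k n) ((k : ℝ) - 1 + 1 / ((k : ℝ) + 1)) ∧
      IsGreatest (pbMean '' bifurcationSet k n) ((k : ℝ) - 1 / ((n : ℝ) - (k : ℝ) + 2))) ∧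
    -- the definite region
    (∀ k : ℕ, k ≤ n → ∀ p ∈ successSimplex n,
      (k : ℝ) - 1 / ((n : ℝ) - (k : ℝ) + 2) < pbMean p →
      pbMean p < (k : ℝ) + 1 / ((k : ℝ) + 2) →
      pbMode p = {k}) ∧
    -- the left endpoint: twin mode exactly at one profile
    (∀ k : ℕ, 1 ≤ k → k ≤ n →
      highProfile k n ∈ meanSection ((k : ℝ) - 1 / ((n : ℝ) - (k : ℝ) + 2)) n ∧
      pbMode (highProfile k n) = {k - 1, k} ∧
      ∀ p ∈ meanSection ((k : ℝ) - 1 / ((n : ℝ) - (k : ℝ) + 2)) n,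
        p ≠ highProfile k n → pbMode p = {k}) ∧
    -- the right endpoint: twin mode exactly at one profile
    (∀ k : ℕ, k < n →
      lowProfile (k + 1) n ∈ meanSection ((k : ℝ) + 1 / ((k : ℝ) + 2)) n ∧
      pbMode (lowProfile (k + 1) n) = {k, k + 1} ∧
      ∀ p ∈ meanSection ((k : ℝ) + 1 / ((k : ℝ) + 2)) n,
        p ≠ lowProfile (k + 1) n → pbMode p = {k}) ∧
    -- the ambiguous band
    (∀ k : ℕ, 1 ≤ k → k ≤ n → ∀ x : ℝ,
      (k : ℝ) - 1 + 1 / ((k : ℝ) + 1) < x → x < (k : ℝ) - 1 / ((n : ℝ) - (k : ℝ) + 2) →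
      (∀ p ∈ meanSection x n,
        pbMode p = {k - 1} ∨ pbMode p = {k} ∨ pbMode p = {k - 1, k}) ∧
      (∃ p ∈ meanSection x n, pbMode p = {k - 1}) ∧
      (∃ p ∈ meanSection x n, pbMode p = {k}) ∧
      (∃ p ∈ meanSection x n, pbMode p = {k - 1, k})) := by
  refine ⟨fun k hk1 hk => ?_, fun k hk p hp hx hx' => ?_, fun k hk1 hk => ?_, fun k hk => ?_,
    fun k hk1 hk x hx hx' => ?_⟩
  · obtain ⟨l, rfl⟩ : ∃ l, k = l + 1 := ⟨k - 1, by omega⟩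
    have hlow := pbMean_lowProfile_succ hk
    have hhigh := pbMean_highProfile hk1 hk
    have h1 := one_div_add_two_pos l
    have h2 := one_div_add_two_lt l
    have h3 := lt_highMean hk
    have h4 := highMean_lt hk
    refine ⟨⟨⟨lowProfile (l + 1) n, mem_bifurcationSet (lowProfile_mem _ _) hk (by linarith)
        (by linarith) (pbDiff_lowProfile hk1 hk), pbMean_lowProfile hk⟩, ?_⟩,
      ⟨highProfile (l + 1) n, mem_bifurcationSet (highProfile_mem hk1 hk) hk
        (by push_cast at *; linarith) (by push_cast at *; linarith) (pbDiff_highProfile hk1 hk),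
        hhigh⟩, ?_⟩
    · rintro _ ⟨p, hp, rfl⟩
      exact le_pbMean_of_mem_bifurcationSet hk hp
    · rintro _ ⟨p, hp, rfl⟩
      exact pbMean_le_of_mem_bifurcationSet hk hp
  · refine pbMode_eq_singleton_of_mean hp hk hx.le hx'.le ?_ ?_
    · rintro h rfl
      exact hx.ne (pbMean_highProfile h hk).symm
    · rintro h rfl
      exact hx'.ne (pbMean_lowProfile_succ h)
  · have hmean := pbMean_highProfile hk1 hk
    have h3 := lt_highMean hk
    have h4 := highMean_lt hk
    refine ⟨⟨highProfile_mem hk1 hk, hmean⟩, ?_, fun p hp hne => ?_⟩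
    · obtain ⟨l, rfl⟩ : ∃ l, k = l + 1 := ⟨k - 1, by omega⟩
      exact (pbMode_of_mean_between (highProfile_mem hk1 hk) hk (by push_cast at *; linarith)
        (by push_cast at *; linarith)).2.2 (pbDiff_highProfile hk1 hk)
    · have h5 := one_div_add_two_pos k
      refine pbMode_eq_singleton_of_mean hp.1 hk hp.2.ge (by linarith [hp.2]) (fun _ => hne) ?_
      rintro h rfl
      have := hp.2
      rw [pbMean_lowProfile_succ h] at this
      linarith
  · have hmean := pbMean_lowProfile_succ hk
    have h1 := one_div_add_two_pos k
    have h2 := one_div_add_two_lt k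
    refine ⟨⟨lowProfile_mem _ _, hmean⟩, ?_, fun p hp hne => ?_⟩
    · exact (pbMode_of_mean_between (lowProfile_mem _ _) hk (by linarith) (by linarith)).2.2
        (pbDiff_lowProfile (by omega) hk)
    · have h4 := highMean_lt hk.le
      refine pbMode_eq_singleton_of_mean hp.1 hk.le (by linarith [hp.2]) hp.2.le ?_ fun _ => hne
      rintro h rfl
      have := hp.2
      rw [pbMean_highProfile h hk.le] at this
      linarith
  · obtain ⟨l, rfl⟩ : ∃ l, k = l + 1 := ⟨k - 1, by omega⟩
    have h4 := highMean_lt hk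
    have hlx : (l : ℝ) + 1 / (l + 2) < x := by
      push_cast at hx
      rwa [add_sub_cancel_right, add_assoc (l : ℝ) 1 1, one_add_one_eq_two] at hx
    have h1 := one_div_add_two_pos l
    have hl : (l : ℝ) < x := by linarith
    have hl' : x < l + 1 := by push_cast at *; linarith
    -- The band lies strictly between `l` and `l + 1`, so the sign of the single difference at `l +
    -- 1` decides the mode.
    have hmode : ∀ p ∈ meanSection x n, _ := fun p hp =>
      pbMode_of_mean_between hp.1 hk (hp.2.symm ▸ hl) (hp.2.symm ▸ hl')
    obtain ⟨p, hp, hpx, hpd⟩ := exists_pbDiff_neg hk hl.le hx'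
    obtain ⟨q, hq, hqx, hqd⟩ := exists_pbDiff_pos hk hlx hl'.le
    obtain ⟨r, hr, hrd⟩ := exists_pbDiff_eq_zero ⟨hp, hpx⟩ ⟨hq, hqx⟩ hpd hqd
    rw [Nat.add_sub_cancel]
    refine ⟨fun s hs => ?_, ⟨p, ⟨hp, hpx⟩, (hmode p ⟨hp, hpx⟩).1 hpd⟩,
      ⟨q, ⟨hq, hqx⟩, (hmode q ⟨hq, hqx⟩).2.1 hqd⟩, ⟨r, hr, (hmode r hr).2.2 hrd⟩⟩
    rcases lt_trichotomy (pbDiff s (l + 1)) 0 with h | h | h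
    · exact Or.inl ((hmode s hs).1 h)
    · exact Or.inr (Or.inr ((hmode s hs).2.2 h))
    · exact Or.inr (Or.inl ((hmode s hs).2.1 h))
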